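/- For $n\ge 1$ let $B(A_n)$ be the group generated by $\sigma_1,\dots,\sigma_n$ with the relations $\sigma_i\sigma_j=\sigma_j\sigma_i$ for $|i-j|\ge 2$ and $\sigma_i\sigma_{i+1}\sigma_i=\sigma_{i+1}\sigma_i\sigma_{i+1}$ for $1\le i\le n-1$. Let $B(B_{n+1})$ be the group generated by $\sigma_1,\dots,\sigma_n,t$ with these relations together with $\sigma_i t=t\sigma_i$ for $2\le i\le n$ and $\sigma_1t\sigma_1t=t\sigma_1t\sigma_1$. Let $B(\tilde A_n)$ be the group generated by $\sigma_1,\dots,\sigma_n,a_{n+1}$ with the relations of $B(A_n)$ together with $\sigma_i a_{n+1}=a_{n+1}\sigma_i$ for $2\le i\le n-1$ and, if $n\ge 2$, $\sigma_i a_{n+1}\sigma_i=a_{n+1}\sigma_i a_{n+1}$ for $i=1$ and $i=n$; so $B(\tilde A_1)$ is free on $\sigma_1,a_2$. For $n\ge1$ put $\phi_{n+1}=t\sigma_1\cdots\sigma_n\in B(B_{n+1})$. There are well-defined group homomorphisms, for $n\ge 1$, $$i_n:B(\tilde A_n)\to B(B_{n+1}),\quad \sigma_i\mapsto\sigma_i\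 (1\le i\le n),\quad a_{n+1}\mapsto\phi_{n+1}\sigma_n\phi_{n+1}^{-1},$$ $$\beta_n:B(\tilde A_n)\to B(A_n),\quad \sigma_i\mapsto\sigma_i\ (1\le i\le n),\quad a_{n+1}\mapsto\sigma_n^{-1}\cdots\sigma_2^{-1}\sigma_1\sigma_2\cdots\sigma_n,$$ and, for $n\ge2$, $$x_n:B(A_{n-1})\to B(A_n),\quad \sigma_i\mapsto\sigma_i\ (1\le i\le n-1),$$ $$y_n:B(B_n)\to B(B_{n+1}),\quad \sigma_i\mapsto\sigma_i\ (1\le i\le n-1),\quad t\mapsto t,$$ $$F_n:B(\tilde A_{n-1})\to B(\tilde A_n),\quad \sigma_i\mapsto\sigma_i\ (1\le i\le n-1),\quad a_n\mapsto\sigma_na_{n+1}\sigma_n^{-1}.$$ For every $n\ge 2$ the homomorphism $F_n$ is injective. Moreover, $i_{n-1}$, $i_n$ and $y_n$ are injective and $i_n\circ F_n=y_n\circ i_{n-1}$, that is, $F_n$ is the restriction of the injection $y_n$ to $B(\tilde A_{n-1})$, viewed as a subgroup of $B(B_n)$; and $x_n\circ\beta_{n-1}=\beta_n\circ F_n$.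 -/

import Mathlib

/-- The word `x y (y x)⁻¹`, whose triviality says that `x` and `y` commute. -/
def commRel {G : Type*} [Group G] (x y : G) : G := x * y * (y * x)⁻¹

/-- The word `x y x (y x y)⁻¹`, whose triviality says that `x y x = y x y`. -/
def braidRel {G : Type*} [Group G] (x y : G) : G := x * y * x * (y * x * y)⁻¹

/-- The word `x y x y (y x y x)⁻¹`, whose triviality says that `x y x y = y x y x`. -/
def braidRel₄ {G : Type*} [Group G] (x y : G) : G := x * y * x * y * (y * x * y * x)⁻¹

/-- The relations of type `A` between `s 0, …, s (n - 1)` (standing for `σ_1, …, σ_n`):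
generators whose indices differ by at least two commute, consecutive ones satisfy the braid
relation. -/
def sigmaRels {G : Type*} [Group G] {n : ℕ} (s : Fin n → G) : Set G :=
  {r | ∃ i j : Fin n, (i : ℕ) + 2 ≤ j ∧ r = commRel (s i) (s j)} ∪
  {r | ∃ i j : Fin n, (i : ℕ) + 1 = j ∧ r = braidRel (s i) (s j)}

/-- The braid group `B(A_n)` of type `A`, with generators `σ_1, …, σ_n`. -/
abbrev BraidA (n : ℕ) : Type :=
  PresentedGroup (sigmaRels (fun i : Fin n => FreeGroup.of i))

namespace BraidA

/-- The generator `σ_{i+1}` of `B(A_n)`. -/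
def sigma {n : ℕ} (i : Fin n) : BraidA n := PresentedGroup.of i

end BraidA

/-- The generators `σ_1, …, σ_n, t` of `B(B_{n+1})`. -/
inductive GenB (n : ℕ) : Type
  | sigma (i : Fin n) : GenB n
  | t : GenB n

/-- The defining relations of `B(B_{n+1})`. -/
def relsB (n : ℕ) : Set (FreeGroup (GenB n)) :=
  sigmaRels (fun i : Fin n => FreeGroup.of (GenB.sigma i)) ∪
  {r | ∃ i : Fin n, 1 ≤ (i : ℕ) ∧
    r = commRel (FreeGroup.of (GenB.sigma i)) (FreeGroup.of GenB.t)} ∪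
  {r | ∃ i : Fin n, (i : ℕ) = 0 ∧
    r = braidRel₄ (FreeGroup.of (GenB.sigma i)) (FreeGroup.of GenB.t)}

/-- The braid group `B(B_{n+1})` of type `B`, with the `n + 1` generators `σ_1, …, σ_n, t`
(note the index: `n` is the number of the `σ`s). -/
abbrev BraidB (n : ℕ) : Type := PresentedGroup (relsB n)

namespace BraidB

/-- The generator `σ_{i+1}` of `B(B_{n+1})`. -/
def sigma {n : ℕ} (i : Fin n) : BraidB n := PresentedGroup.of (GenB.sigma i)

/-- The generator `t` of `B(B_{n+1})`. -/
def t {n : ℕ} : BraidB n := PresentedGroup.of GenB.t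

/-- The element `φ_{n+1} = t σ_1 σ_2 ⋯ σ_n` of `B(B_{n+1})`. -/
def phi (n : ℕ) : BraidB n := t * (List.ofFn (fun i : Fin n => sigma i)).prod

/-- For `n = m + 1`, the element `a_{n+1} = φ_{n+1} σ_n φ_{n+1}⁻¹` of `B(B_{n+1})`. -/
def a (m : ℕ) : BraidB (m + 1) := phi (m + 1) * sigma (Fin.last m) * (phi (m + 1))⁻¹

end BraidB

/-- The generators `σ_1, …, σ_n, a_{n+1}` of `B(Ã_n)`. -/
inductive GenAff (n : ℕ) : Type
  | sigma (i : Fin n) : GenAff n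
  | a : GenAff n

/-- The defining relations of `B(Ã_n)`: the relations of type `A` between the `σ`s, `a_{n+1}`
commutes with `σ_2, …, σ_{n-1}`, and, for `n ≥ 2`, it satisfies the braid relation with `σ_1` and
with `σ_n`. There is no relation for `n = 1`: the group `B(Ã_1)` is free on `σ_1, a_2`. -/
def relsAff (n : ℕ) : Set (FreeGroup (GenAff n)) :=
  sigmaRels (fun i : Fin n => FreeGroup.of (GenAff.sigma i)) ∪
  {r | ∃ i : Fin n, 1 ≤ (i : ℕ) ∧ (i : ℕ) + 1 < n ∧
    r = commRel (FreeGroup.of (GenAff.sigma i)) (FreeGroup.of GenAff.a)} ∪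
  {r | ∃ i : Fin n, 2 ≤ n ∧ ((i : ℕ) = 0 ∨ (i : ℕ) + 1 = n) ∧
    r = braidRel (FreeGroup.of (GenAff.sigma i)) (FreeGroup.of GenAff.a)}

/-- The affine braid group `B(Ã_n)`, with generators `σ_1, …, σ_n, a_{n+1}`. -/
abbrev BraidAff (n : ℕ) : Type := PresentedGroup (relsAff n)

namespace BraidAff

/-- The generator `σ_{i+1}` of `B(Ã_n)`. -/
def sigma {n : ℕ} (i : Fin n) : BraidAff n := PresentedGroup.of (GenAff.sigma i)

/-- The generator `a_{n+1}` of `B(Ã_n)`. -/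
def a {n : ℕ} : BraidAff n := PresentedGroup.of GenAff.a

end BraidAff

/-- For `n = m + 1`, the element
`σ_n⁻¹ ⋯ σ_2⁻¹ σ_1 σ_2 ⋯ σ_n = (σ_2 ⋯ σ_n)⁻¹ σ_1 (σ_2 ⋯ σ_n)` of `B(A_n)`. -/
def BraidA.b (m : ℕ) : BraidA (m + 1) :=
  ((List.ofFn (fun i : Fin m => BraidA.sigma i.succ)).prod)⁻¹ * BraidA.sigma 0 *
    (List.ofFn (fun i : Fin m => BraidA.sigma i.succ)).prod

/-! Injectivity of `F` is inherited from the square `i₂ ∘ F = y ∘ i₁`: once `i₁` and `y` are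
injective, so is `i₂ ∘ F`, hence `F`.

For the maps `i`, conjugation by `φ = t σ_1 ⋯ σ_n` rotates `σ_1, …, σ_n, a_{n+1}` cyclically, by
`IsBraidB.phi_mul` and `IsBraidA.phi_sq_iff`. The same rotation is an automorphism of `B(Ã_n)`
(`BraidAff.exists_rotation`), so `B(B_{n+1})` maps to `B(Ã_n) ⋊ ℤ` with `φ` going to the generator
of `ℤ`. Composed with `i`, this is the canonical inclusion, so `i` is injective.

For `y`, a braid of type `B` acts on pairs (position of a strand, element of the smaller group): the
strand is moved, and the element is multiplied by what remains of the braid when that strand is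
deleted. A braid in the image of `y` fixes the last strand, and deleting it returns the original
braid.

The map `F` needs no relation check in `B(Ã_n)`: `BraidB.map_a` shows that `y ∘ i₁` takes the
generators to the `i₂`-images of their prescribed values, so the relations pull back along the
injection `i₂`. The square with `β` only needs a check on `a`, given by `BraidA.map_b`. -/

/-! ### Families of generators indexed by the natural numbers -/

section Families

variable {G H : Type*} [Group G] [Group H]

/-- The elements `s 0, …, s (n - 1)` satisfy the braid relations of type `A_n`. -/
structure IsBraidA (n : ℕ) (s : ℕ → G) : Prop where
  comm : ∀ i j, i + 2 ≤ j → j < n → s i * s j = s j * s i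
  braid : ∀ i, i + 1 < n → s i * s (i + 1) * s i = s (i + 1) * s i * s (i + 1)

/-- The elements `s 0, …, s (n - 1)` and `t` satisfy the braid relations of type `B_{n+1}`. -/
structure IsBraidB (n : ℕ) (s : ℕ → G) (t : G) : Prop extends IsBraidA n s where
  comm_t : ∀ i, 1 ≤ i → i < n → s i * t = t * s i
  braid_t : 0 < n → s 0 * t * s 0 * t = t * s 0 * t * s 0

/-- The elements `s 0, …, s (n - 1)` and `a` satisfy the braid relations of type `Ã_n`. -/
structure IsBraidAff (n : ℕ) (s : ℕ → G) (a : G) : Prop extends IsBraidA n s where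
  comm_a : ∀ i, 1 ≤ i → i + 1 < n → s i * a = a * s i
  braid_a : ∀ i, i < n → 2 ≤ n → (i = 0 ∨ i + 1 = n) → s i * a * s i = a * s i * a

/-- The extension of a finite family by `1`. -/
def extendOne {n : ℕ} (f : Fin n → G) (k : ℕ) : G := if h : k < n then f ⟨k, h⟩ else 1

@[simp] theorem extendOne_val {n : ℕ} (f : Fin n → G) (j : Fin n) : extendOne f j = f j := by
  simp [extendOne]

theorem extendOne_of_lt {n : ℕ} (f : Fin n → G) {k : ℕ} (h : k < n) :
    extendOne f k = f ⟨k, h⟩ := by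
  simp [extendOne, h]

/-- The product `s 0 * s 1 * ⋯ * s (k - 1)`. -/
def initProd (s : ℕ → G) (k : ℕ) : G := ((List.range k).map s).prod

@[simp] theorem initProd_zero (s : ℕ → G) : initProd s 0 = 1 := by simp [initProd]

theorem initProd_succ (s : ℕ → G) (k : ℕ) : initProd s (k + 1) = initProd s k * s k := by
  simp [initProd, List.range_succ]

theorem initProd_succ' (s : ℕ → G) (k : ℕ) :
    initProd s (k + 1) = s 0 * initProd (fun i => s (i + 1)) k := by
  simp [initProd, List.range_succ_eq_map, Function.comp_def]

theorem initProd_congr {s s' : ℕ → G} {k : ℕ} (h : ∀ i < k, s i = s' i) :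
    initProd s k = initProd s' k := by
  simp only [initProd]
  congr 1
  exact List.map_congr_left fun i hi => h i (List.mem_range.1 hi)

theorem map_initProd (f : G →* H) (s : ℕ → G) (k : ℕ) :
    f (initProd s k) = initProd (fun i => f (s i)) k := by
  simp [initProd, map_list_prod, Function.comp_def]

theorem prod_ofFn_eq_initProd {n : ℕ} (f : Fin n → G) (s : ℕ → G) (h : ∀ j : Fin n, f j = s j) :
    (List.ofFn f).prod = initProd s n := by
  induction n with
  | zero => simp
  | succ n ih =>
    rw [List.ofFn_succ', List.concat_eq_append, List.prod_append, initProd_succ,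
      ih _ fun j => by simpa using h j.castSucc]
    simp [h]

theorem initProd_commute {s : ℕ → G} {k : ℕ} {g : G} (h : ∀ i < k, s i * g = g * s i) :
    initProd s k * g = g * initProd s k := by
  induction k with
  | zero => simp
  | succ k ih =>
    rw [initProd_succ, mul_assoc, h k (by omega), ← mul_assoc, ih fun i hi => h i (by omega),
      mul_assoc]

/-! ### Shift identities for the products `σ_1 ⋯ σ_k` -/

namespace IsBraidA

variable {n : ℕ} {s : ℕ → G}

theorem mono (h : IsBraidA n s) {m : ℕ} (hm : m ≤ n) : IsBraidA m s :=
  ⟨fun i j hij hj => h.comm i j hij (hj.trans_le hm), fun i hi => h.braid i (hi.trans_le hm)⟩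

theorem initProd_mul_of_lt (h : IsBraidA n s) {k j : ℕ} (hk : k < j) (hj : j < n) :
    initProd s k * s j = s j * initProd s k :=
  initProd_commute fun i hi => h.comm i j (by omega) hj

/-- `s i` passes the factors of index above `i + 1`, turns into `s (i + 1)` by the braid relation,
and then passes those of index below `i`. -/
theorem initProd_mul (h : IsBraidA n s) {k i : ℕ} (hi : i + 1 < k) (hk : k ≤ n) :
    initProd s k * s i = s (i + 1) * initProd s k := by
  induction k with
  | zero => omega
  | succ k ih =>
    rcases Nat.lt_or_ge (i + 1) k with hik | hik
    · rw [initProd_succ, mul_assoc, ← h.comm i k (by omega) (by omega), ← mul_assoc,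
        ih hik (by omega), mul_assoc]
    · obtain rfl : k = i + 1 := by omega
      rw [initProd_succ, initProd_succ]
      calc initProd s i * s i * s (i + 1) * s i
          = initProd s i * (s i * s (i + 1) * s i) := by group
        _ = initProd s i * s (i + 1) * s i * s (i + 1) := by rw [h.braid i (by omega)]; group
        _ = _ := by rw [h.initProd_mul_of_lt (by omega) (by omega)]; group

/-- The recursion that drives the induction in `initProd_sq_mul`. -/
theorem initProd_sq_succ (h : IsBraidA n s) {k : ℕ} (hk : k + 1 < n) :
    initProd s (k + 2) * initProd s (k + 2) =
      initProd s (k + 1) * initProd s (k + 1) * s (k + 1) * s k := by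
  calc initProd s (k + 2) * initProd s (k + 2)
      = initProd s (k + 1) * (s (k + 1) * initProd s k) * s k * s (k + 1) := by
        simp only [initProd_succ]; group
    _ = initProd s (k + 1) * initProd s k * (s (k + 1) * s k * s (k + 1)) := by
        rw [← h.initProd_mul_of_lt (Nat.lt_succ_self k) hk]; group
    _ = _ := by rw [← h.braid k hk]; simp only [initProd_succ]; group

/-- Wrap-around for the shift `initProd_mul`: the square of the product carries the last generator
to the first. It is the type `A` input to `phi_sq_iff`. -/
theorem initProd_sq_mul (h : IsBraidA n s) {k : ℕ} (hk : k < n) :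
    initProd s (k + 1) * initProd s (k + 1) * s k =
      s 0 * (initProd s (k + 1) * initProd s (k + 1)) := by
  induction k with
  | zero => simp [initProd_succ, mul_assoc]
  | succ k ih =>
    rw [h.initProd_sq_succ hk]
    calc initProd s (k + 1) * initProd s (k + 1) * s (k + 1) * s k * s (k + 1)
        = initProd s (k + 1) * initProd s (k + 1) * (s (k + 1) * s k * s (k + 1)) := by group
      _ = initProd s (k + 1) * initProd s (k + 1) * s k * s (k + 1) * s k := by
        rw [← h.braid k hk]; group
      _ = _ := by rw [ih (by omega)]; group

/-- The two expressions `(σ_1 ⋯ σ_k) σ_{k+1} (σ_1 ⋯ σ_k)⁻¹` and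
`(σ_2 ⋯ σ_{k+1})⁻¹ σ_1 (σ_2 ⋯ σ_{k+1})` agree. -/
theorem initProd_conj (h : IsBraidA n s) {k : ℕ} (hk : k < n) :
    initProd s k * s k * (initProd s k)⁻¹ =
      (initProd (fun i => s (i + 1)) k)⁻¹ * s 0 * initProd (fun i => s (i + 1)) k := by
  induction k with
  | zero => simp
  | succ k ih =>
    rw [initProd_succ (fun i => s (i + 1))]
    calc initProd s (k + 1) * s (k + 1) * (initProd s (k + 1))⁻¹
        = initProd s k * (s k * s (k + 1) * (s k)⁻¹) * (initProd s k)⁻¹ := by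
          rw [initProd_succ]; group
      _ = initProd s k * ((s (k + 1))⁻¹ * s k * s (k + 1)) * (initProd s k)⁻¹ := by
          congr 2
          have := h.braid k hk
          rw [mul_inv_eq_iff_eq_mul, mul_assoc, mul_assoc, eq_inv_mul_iff_mul_eq, ← mul_assoc,
            ← mul_assoc, this]
      _ = (s (k + 1))⁻¹ * (initProd s k * s k * (initProd s k)⁻¹) * s (k + 1) := by
          have hc : Commute (initProd s k) (s (k + 1)) :=
            h.initProd_mul_of_lt (Nat.lt_succ_self k) hk
          have e1 := hc.inv_right.eq
          have e2 := hc.inv_left.eq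
          rw [← mul_assoc, ← mul_assoc, e1, mul_assoc _ (s (k + 1)), ← e2]; group
      _ = _ := by rw [ih (by omega)]; group

end IsBraidA

namespace IsBraidB

variable {n : ℕ} {s : ℕ → G} {t : G}

/-- The shift by `initProd s n` survives the factor `t`, because `t` commutes with every `s (i +
1)`. -/
theorem phi_mul (h : IsBraidB n s t) {i : ℕ} (hi : i + 1 < n) :
    t * initProd s n * s i = s (i + 1) * (t * initProd s n) := by
  rw [mul_assoc, h.initProd_mul hi le_rfl, ← mul_assoc, ← h.comm_t _ (by omega) hi, mul_assoc]

end IsBraidB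

/-- If `t` commutes with `σ_2, …, σ_{n+1}`, then the relation `σ_1 t σ_1 t = t σ_1 t σ_1` says that
the square of `φ = t σ_1 ⋯ σ_{n+1}` conjugates `σ_{n+1}` to `σ_1`. -/
theorem IsBraidA.phi_sq_iff {n : ℕ} {s : ℕ → G} {t : G} (h : IsBraidA (n + 1) s)
    (ht : ∀ i, 1 ≤ i → i < n + 1 → s i * t = t * s i) :
    (t * initProd s (n + 1)) * (t * initProd s (n + 1)) * s n =
        s 0 * ((t * initProd s (n + 1)) * (t * initProd s (n + 1))) ↔
      s 0 * t * s 0 * t = t * s 0 * t * s 0 := by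
  have hsq := h.initProd_sq_mul (Nat.lt_succ_self n)
  rw [initProd_succ'] at hsq ⊢
  set Q := initProd (fun i => s (i + 1)) n
  have hQ : Q * t = t * Q := initProd_commute fun i hi => ht _ (by omega) (by omega)
  -- With `t` moved to the left of `Q`, this makes both sides of the first equation end in `Q * s 0
  -- * Q`; cancelling that factor leaves the relation between `s 0` and `t`.
  have hQ' : Q * s 0 * Q * s n = s 0 * Q * s 0 * Q := by
    apply mul_left_cancel (a := s 0)
    simpa only [mul_assoc] using hsq
  have e1 : t * (s 0 * Q) * (t * (s 0 * Q)) = t * s 0 * t * (Q * s 0 * Q) := by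
    calc _ = t * s 0 * (Q * t) * s 0 * Q := by group
      _ = _ := by rw [hQ]; group
  have e2 : t * s 0 * t * (Q * s 0 * Q) * s n = t * s 0 * t * s 0 * (Q * s 0 * Q) := by
    rw [mul_assoc, hQ']; group
  have e3 : s 0 * (t * s 0 * t * (Q * s 0 * Q)) = s 0 * t * s 0 * t * (Q * s 0 * Q) := by group
  rw [e1, e2, e3, mul_left_inj, eq_comm]

/-- The elements `σ_1, …, σ_{n+1}` and `φ σ_{n+1} φ⁻¹` satisfy the relations of type `Ã_{n+1}`. -/
theorem IsBraidB.isBraidAff {n : ℕ} {s : ℕ → G} {t : G} (h : IsBraidB (n + 1) s t) :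
    IsBraidAff (n + 1) s
      (t * initProd s (n + 1) * s n * (t * initProd s (n + 1))⁻¹) := by
  -- Conjugation by `φ` moves each term of `s 0, …, s n, φ * s n * φ⁻¹` to the next and the last to
  -- `s 0`, so the relations with the new generator are transported from type `A`.
  have h1 : ∀ i, i + 1 < n + 1 → s (i + 1) =
      MulAut.conj (t * initProd s (n + 1)) (s i) := fun i hi => by
    rw [MulAut.conj_apply, h.phi_mul hi, mul_inv_cancel_right]
  have h2 : s 0 = MulAut.conj (t * initProd s (n + 1))
      (MulAut.conj (t * initProd s (n + 1)) (s n)) := by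
    have := (h.toIsBraidA.phi_sq_iff h.comm_t).2 (h.braid_t (Nat.succ_pos n))
    rw [← MulAut.mul_apply, ← map_mul, MulAut.conj_apply, this, mul_inv_cancel_right]
  rw [← MulAut.conj_apply]
  set c := MulAut.conj (t * initProd s (n + 1))
  have h3 : ∀ i, i + 1 = n + 1 → 1 ≤ n → s i * c (s n) * s i = c (s n) * s i * c (s n) := by
    intro i hi hn
    obtain ⟨k, rfl⟩ : ∃ k, n = k + 1 := ⟨n - 1, by omega⟩
    obtain rfl : i = k + 1 := by omega
    have := congrArg c (h.braid k (by omega))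
    simp only [map_mul] at this
    rw [← h1 k (by omega)] at this
    exact this
  refine ⟨h.toIsBraidA, fun i hi hin => ?_, fun i hi hn hin => ?_⟩
  · obtain ⟨k, rfl⟩ : ∃ k, i = k + 1 := ⟨i - 1, by omega⟩
    rw [h1 k (by omega), ← map_mul, ← map_mul, h.comm k n (by omega) (by omega)]
  -- Conjugating the braid relation of `s n` and the new generator gives that of the new generator
  -- and `s 0`.
  · rcases hin with rfl | hin
    · have := congrArg c (h3 n rfl (by omega))
      simp only [map_mul] at this
      rw [← h2] at this
      exact this.symm
    · exact h3 i hin (by omega)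

/-- The relations of type `Ã_{n+1}` are invariant under the rotation of the generators. -/
theorem IsBraidAff.rotate {n : ℕ} {s : ℕ → G} {a : G} (h : IsBraidAff (n + 1) s a) :
    IsBraidAff (n + 1) (fun i => if i < n then s (i + 1) else a) (s 0) := by
  refine ⟨⟨fun i j hij hj => ?_, fun i hi => ?_⟩, fun i hi hin => ?_, fun i hi hn hin => ?_⟩
  · rcases Nat.lt_or_ge j n with hjn | hjn
    · simpa [hjn, show i < n by omega] using h.comm (i + 1) (j + 1) (by omega) (by omega)
    · simpa [show ¬ j < n by omega, show i < n by omega] using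
        h.comm_a (i + 1) (by omega) (by omega)
  · rcases Nat.lt_or_ge (i + 1) n with hjn | hjn
    · simpa [hjn, show i < n by omega] using h.braid (i + 1) (by omega)
    · simpa [show ¬ i + 1 < n by omega, show i < n by omega] using
        h.braid_a (i + 1) (by omega) (by omega) (by omega)
  · simpa [show i < n by omega] using (h.comm 0 (i + 1) (by omega) (by omega)).symm
  · rcases Nat.lt_or_ge i n with hjn | hjn
    · obtain rfl : i = 0 := by omega
      simpa [hjn] using (h.braid 0 (by omega)).symm
    · simpa [show ¬ i < n by omega] using (h.braid_a 0 (by omega) (by omega) (by omega)).symm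

/-- The relations of type `Ã_{n+1}` are invariant under the inverse rotation of the generators. -/
theorem IsBraidAff.rotate_symm {n : ℕ} {s : ℕ → G} {a : G} (h : IsBraidAff (n + 1) s a) :
    IsBraidAff (n + 1) (fun i => if i = 0 then a else s (i - 1)) (s n) := by
  refine ⟨⟨fun i j hij hj => ?_, fun i hi => ?_⟩, fun i hi hin => ?_, fun i hi hn hin => ?_⟩
  · rcases Nat.eq_zero_or_pos i with rfl | hi
    · simpa [show j ≠ 0 by omega] using (h.comm_a (j - 1) (by omega) (by omega)).symm
    · simpa [show j ≠ 0 by omega, show i ≠ 0 by omega] using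
        h.comm (i - 1) (j - 1) (by omega) (by omega)
  · rcases Nat.eq_zero_or_pos i with rfl | hi'
    · simpa using (h.braid_a 0 (by omega) (by omega) (by omega)).symm
    · have := h.braid (i - 1) (by omega)
      rw [show i - 1 + 1 = i by omega] at this
      simpa [show i ≠ 0 by omega] using this
  · simpa [show i ≠ 0 by omega] using h.comm (i - 1) n (by omega) (by omega)
  · rcases Nat.eq_zero_or_pos i with rfl | hi'
    · simpa using (h.braid_a n (by omega) (by omega) (by omega)).symm
    · have := h.braid (i - 1) (by omega)
      rw [show i - 1 + 1 = n by omega] at this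
      simpa [show i ≠ 0 by omega] using this

end Families

/-! ### Universal properties of the three families of groups -/

section Lift

variable {G H : Type*} [Group G] [Group H]

theorem commRel_eq_one {x y : G} : commRel x y = 1 ↔ x * y = y * x := mul_inv_eq_one

theorem braidRel_eq_one {x y : G} : braidRel x y = 1 ↔ x * y * x = y * x * y := mul_inv_eq_one

theorem braidRel₄_eq_one {x y : G} : braidRel₄ x y = 1 ↔ x * y * x * y = y * x * y * x :=
  mul_inv_eq_one

theorem map_commRel (f : G →* H) (x y : G) : f (commRel x y) = commRel (f x) (f y) := by
  simp [commRel]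

theorem map_braidRel (f : G →* H) (x y : G) : f (braidRel x y) = braidRel (f x) (f y) := by
  simp [braidRel]

theorem map_braidRel₄ (f : G →* H) (x y : G) : f (braidRel₄ x y) = braidRel₄ (f x) (f y) := by
  simp [braidRel₄]

/-- A homomorphism kills the relations of type `A` between `x 0, …, x (n - 1)` if and only if the
images satisfy the braid relations. -/
theorem forall_sigmaRels_iff {n : ℕ} (f : G →* H) (x : Fin n → G) (s : ℕ → H)
    (hs : ∀ j : Fin n, f (x j) = s j) :
    (∀ r ∈ sigmaRels x, f r = 1) ↔ IsBraidA n s := by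
  constructor
  · intro h
    refine ⟨fun i j hij hj => ?_, fun i hi => ?_⟩
    · have := h _ (Or.inl ⟨⟨i, by omega⟩, ⟨j, hj⟩, hij, rfl⟩)
      rwa [map_commRel, hs, hs, commRel_eq_one] at this
    · have := h _ (Or.inr ⟨⟨i, by omega⟩, ⟨i + 1, hi⟩, rfl, rfl⟩)
      rwa [map_braidRel, hs, hs, braidRel_eq_one] at this
  · rintro h r (⟨i, j, hij, rfl⟩ | ⟨i, j, hij, rfl⟩)
    · rw [map_commRel, hs, hs, commRel_eq_one]
      exact h.comm i j hij j.2
    · rw [map_braidRel, hs, hs, braidRel_eq_one, ← hij]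
      exact h.braid i (by omega)

theorem forall_relsB_iff {n : ℕ} (f : FreeGroup (GenB n) →* G) (s : ℕ → G)
    (hs : ∀ j : Fin n, f (FreeGroup.of (GenB.sigma j)) = s j) :
    (∀ r ∈ relsB n, f r = 1) ↔ IsBraidB n s (f (FreeGroup.of GenB.t)) := by
  constructor
  · intro h
    refine ⟨(forall_sigmaRels_iff f _ s hs).1 fun r hr => h r (Or.inl (Or.inl hr)),
      fun i hi hin => ?_, fun hn => ?_⟩
    · have := h _ (Or.inl (Or.inr ⟨⟨i, hin⟩, hi, rfl⟩))
      rwa [map_commRel, hs, commRel_eq_one] at this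
    · have := h _ (Or.inr ⟨⟨0, hn⟩, rfl, rfl⟩)
      rwa [map_braidRel₄, hs, braidRel₄_eq_one] at this
  · rintro h r ((hr | ⟨i, hi, rfl⟩) | ⟨i, hi, rfl⟩)
    · exact (forall_sigmaRels_iff f _ s hs).2 h.toIsBraidA r hr
    · rw [map_commRel, hs, commRel_eq_one]
      exact h.comm_t i hi i.2
    · rw [map_braidRel₄, hs, braidRel₄_eq_one, hi]
      exact h.braid_t (by omega)

theorem forall_relsAff_iff {n : ℕ} (f : FreeGroup (GenAff n) →* G) (s : ℕ → G)
    (hs : ∀ j : Fin n, f (FreeGroup.of (GenAff.sigma j)) = s j) :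
    (∀ r ∈ relsAff n, f r = 1) ↔ IsBraidAff n s (f (FreeGroup.of GenAff.a)) := by
  constructor
  · intro h
    refine ⟨(forall_sigmaRels_iff f _ s hs).1 fun r hr => h r (Or.inl (Or.inl hr)),
      fun i hi hin => ?_, fun i hi hn hin => ?_⟩
    · have := h _ (Or.inl (Or.inr ⟨⟨i, by omega⟩, hi, hin, rfl⟩))
      rwa [map_commRel, hs, commRel_eq_one] at this
    · have := h _ (Or.inr ⟨⟨i, hi⟩, hn, hin, rfl⟩)
      rwa [map_braidRel, hs, braidRel_eq_one] at this
  · rintro h r ((hr | ⟨i, hi, hin, rfl⟩) | ⟨i, hn, hin, rfl⟩)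
    · exact (forall_sigmaRels_iff f _ s hs).2 h.toIsBraidA r hr
    · rw [map_commRel, hs, commRel_eq_one]
      exact h.comm_a i hi hin
    · rw [map_braidRel, hs, braidRel_eq_one]
      exact h.braid_a i i.2 hn hin

theorem IsBraidA.exists_hom {n : ℕ} {s : ℕ → G} (h : IsBraidA n s) :
    ∃ f : BraidA n →* G, ∀ j, f (BraidA.sigma j) = s j :=
  ⟨PresentedGroup.toGroup ((forall_sigmaRels_iff
      (FreeGroup.lift fun j : Fin n => s j) _ s (by simp)).2 h),
    fun j => PresentedGroup.toGroup.of _⟩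

theorem IsBraidB.exists_hom {n : ℕ} {s : ℕ → G} {t : G} (h : IsBraidB n s t) :
    ∃ f : BraidB n →* G, (∀ j, f (BraidB.sigma j) = s j) ∧ f BraidB.t = t :=
  ⟨PresentedGroup.toGroup (f := fun g => match g with
      | GenB.sigma j => s j
      | GenB.t => t) ((forall_relsB_iff _ s (by simp)).2 (by simpa using h)),
    fun j => PresentedGroup.toGroup.of _, PresentedGroup.toGroup.of _⟩

theorem IsBraidAff.exists_hom {n : ℕ} {s : ℕ → G} {a : G} (h : IsBraidAff n s a) :
    ∃ f : BraidAff n →* G, (∀ j, f (BraidAff.sigma j) = s j) ∧ f BraidAff.a = a :=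
  ⟨PresentedGroup.toGroup (f := fun g => match g with
      | GenAff.sigma j => s j
      | GenAff.a => a) ((forall_relsAff_iff _ s (by simp)).2 (by simpa using h)),
    fun j => PresentedGroup.toGroup.of _, PresentedGroup.toGroup.of _⟩

theorem isBraidA_sigma (n : ℕ) : IsBraidA n (extendOne (BraidA.sigma (n := n))) :=
  (forall_sigmaRels_iff (PresentedGroup.mk _) _ _ fun j => (extendOne_val BraidA.sigma j).symm).1
    fun _ hr => PresentedGroup.one_of_mem hr

theorem isBraidB_sigma (n : ℕ) :
    IsBraidB n (extendOne (BraidB.sigma (n := n))) BraidB.t :=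
  (forall_relsB_iff (PresentedGroup.mk _) _ fun j => (extendOne_val BraidB.sigma j).symm).1
    fun _ hr => PresentedGroup.one_of_mem hr

theorem isBraidAff_sigma (n : ℕ) :
    IsBraidAff n (extendOne (BraidAff.sigma (n := n))) BraidAff.a :=
  (forall_relsAff_iff (PresentedGroup.mk _) _ fun j => (extendOne_val BraidAff.sigma j).symm).1
    fun _ hr => PresentedGroup.one_of_mem hr

theorem BraidB.hom_ext {n : ℕ} {f g : BraidB n →* G}
    (hs : ∀ j, f (sigma j) = g (sigma j)) (ht : f t = g t) : f = g :=
  PresentedGroup.ext fun x => by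
    cases x with
    | sigma i => exact hs i
    | t => exact ht

theorem BraidAff.hom_ext {n : ℕ} {f g : BraidAff n →* G}
    (hs : ∀ j, f (sigma j) = g (sigma j)) (ha : f a = g a) : f = g :=
  PresentedGroup.ext fun x => by
    cases x with
    | sigma i => exact hs i
    | a => exact ha

theorem IsBraidA.map {n : ℕ} {s : ℕ → G} (h : IsBraidA n s) (f : G →* H) :
    IsBraidA n (fun i => f (s i)) :=
  ⟨fun i j hij hj => by simp only [← map_mul, h.comm i j hij hj],
    fun i hi => by simp only [← map_mul, h.braid i hi]⟩

theorem IsBraidAff.map_hom {n : ℕ} (f : BraidAff n →* G) {s : ℕ → G}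
    (hs : ∀ j, f (BraidAff.sigma j) = s j) : IsBraidAff n s (f BraidAff.a) :=
  (forall_relsAff_iff (f.comp (PresentedGroup.mk _)) _ hs).1 fun r hr => by
    rw [MonoidHom.comp_apply, PresentedGroup.one_of_mem hr, map_one]

/-- Allows the relations needed to define `F` to be checked in the type `B` group. -/
theorem IsBraidAff.of_map {n : ℕ} {s : ℕ → G} {a : G} (f : G →* H)
    (hf : Function.Injective f) (h : IsBraidAff n (fun i => f (s i)) (f a)) :
    IsBraidAff n s a :=
  ⟨⟨fun i j hij hj => hf (by simpa using h.comm i j hij hj),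
    fun i hi => hf (by simpa using h.braid i hi)⟩,
    fun i hi hin => hf (by simpa using h.comm_a i hi hin),
    fun i hi hn hin => hf (by simpa using h.braid_a i hi hn hin)⟩

end Lift

/-! ### Forgetting a strand: `B(B_{n+1})` embeds into `B(B_{n+2})` -/

section Forget

variable {G : Type*} [Group G]

/-- The result of removing the strand at position `k` from `σ_{i+1}`; positions above `n + 1` are
ignored. -/
def forgetSigma (n : ℕ) (s : ℕ → G) (i k : ℕ) : G :=
  -- For `i ≤ n`, the cutoff `n + 1 < k` excludes the value `s n`, about which no relation is
  -- assumed.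
  if k < i then s (i - 1) else if k ≤ i + 1 ∨ n + 1 < k then 1 else s i

/-- The result of removing the strand at position `k` from `t`; positions above `n + 1` are
ignored. -/
def forgetT (n : ℕ) (t : G) (k : ℕ) : G := if k = 0 ∨ n + 1 < k then 1 else t

/-- A crossing disappears whichever of its two strands is removed. This makes `sigmaPerm`
invertible. -/
theorem forgetSigma_swap (n : ℕ) (s : ℕ → G) (i k : ℕ) :
    forgetSigma n s i (Equiv.swap i (i + 1) k) = forgetSigma n s i k := by
  unfold forgetSigma
  rw [Equiv.swap_apply_def]
  split_ifs <;> first | rfl | omega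

/-- The permutation of `ℕ × G` by which `σ_{i+1}` acts when strands are forgotten. -/
def sigmaPerm (n : ℕ) (s : ℕ → G) (i : ℕ) : Equiv.Perm (ℕ × G) where
  toFun p := (Equiv.swap i (i + 1) p.1, forgetSigma n s i p.1 * p.2)
  invFun p := (Equiv.swap i (i + 1) p.1, (forgetSigma n s i p.1)⁻¹ * p.2)
  left_inv p := by simp [forgetSigma_swap]
  right_inv p := by simp [forgetSigma_swap]

/-- The permutation of `ℕ × G` by which `t` acts when strands are forgotten. -/
def tPerm (n : ℕ) (t : G) : Equiv.Perm (ℕ × G) where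
  toFun p := (p.1, forgetT n t p.1 * p.2)
  invFun p := (p.1, (forgetT n t p.1)⁻¹ * p.2)
  left_inv p := by simp
  right_inv p := by simp

theorem sigmaPerm_apply (n : ℕ) (s : ℕ → G) (i k : ℕ) (g : G) :
    sigmaPerm n s i (k, g) = (Equiv.swap i (i + 1) k, forgetSigma n s i k * g) := rfl

theorem tPerm_apply (n : ℕ) (t : G) (k : ℕ) (g : G) :
    tPerm n t (k, g) = (k, forgetT n t k * g) := rfl

theorem sigmaPerm_of_lt (n : ℕ) (s : ℕ → G) {i k : ℕ} (h : k < i) (g : G) :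
    sigmaPerm n s i (k, g) = (k, s (i - 1) * g) := by
  rw [sigmaPerm_apply, Equiv.swap_apply_of_ne_of_ne (by omega) (by omega), forgetSigma, if_pos h]

theorem sigmaPerm_self (n : ℕ) (s : ℕ → G) (i : ℕ) (g : G) :
    sigmaPerm n s i (i, g) = (i + 1, g) := by
  simp [sigmaPerm_apply, forgetSigma]

theorem sigmaPerm_succ (n : ℕ) (s : ℕ → G) (i : ℕ) (g : G) :
    sigmaPerm n s i (i + 1, g) = (i, g) := by
  simp [sigmaPerm_apply, forgetSigma]

theorem sigmaPerm_of_gt (n : ℕ) (s : ℕ → G) {i k : ℕ} (h : i + 1 < k) (hk : k ≤ n + 1) (g : G) :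
    sigmaPerm n s i (k, g) = (k, s i * g) := by
  rw [sigmaPerm_apply, Equiv.swap_apply_of_ne_of_ne (by omega) (by omega), forgetSigma,
    if_neg (by omega), if_neg (by omega)]

theorem sigmaPerm_of_large (n : ℕ) (s : ℕ → G) {i k : ℕ} (h : i + 1 < k) (hk : n + 1 < k)
    (g : G) : sigmaPerm n s i (k, g) = (k, g) := by
  rw [sigmaPerm_apply, Equiv.swap_apply_of_ne_of_ne (by omega) (by omega), forgetSigma,
    if_neg (by omega), if_pos (by omega), one_mul]

theorem tPerm_zero (n : ℕ) (t : G) (g : G) : tPerm n t (0, g) = (0, g) := by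
  simp [tPerm_apply, forgetT]

theorem tPerm_of_pos (n : ℕ) (t : G) {k : ℕ} (h : 0 < k) (hk : k ≤ n + 1) (g : G) :
    tPerm n t (k, g) = (k, t * g) := by
  rw [tPerm_apply, forgetT, if_neg (by omega)]

theorem tPerm_of_large (n : ℕ) (t : G) {k : ℕ} (hk : n + 1 < k) (g : G) :
    tPerm n t (k, g) = (k, g) := by
  rw [tPerm_apply, forgetT, if_pos (by omega), one_mul]

/-- Forgetting strands turns the relations of type `A_n` into those of type `A_{n+1}`. -/
theorem IsBraidA.sigmaPerm {n : ℕ} {s : ℕ → G} (h : IsBraidA n s) :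
    IsBraidA (n + 1) (sigmaPerm n s) := by
  have hc : ∀ i j, i + 2 ≤ j → j < n → ∀ g, s i * (s j * g) = s j * (s i * g) :=
    fun i j hij hj g => by rw [← mul_assoc, h.comm i j hij hj, mul_assoc]
  have hb : ∀ i, i + 1 < n → ∀ g, s i * (s (i + 1) * (s i * g)) =
      s (i + 1) * (s i * (s (i + 1) * g)) := fun i hi g => by
    simpa only [mul_assoc] using congrArg (· * g) (h.braid i hi)
  refine ⟨fun i j hij hj => Equiv.ext ?_, fun i hi => Equiv.ext ?_⟩
  · rintro ⟨k, g⟩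
    simp only [Equiv.Perm.mul_apply]
    -- If the removed strand meets one of the crossings, that crossing disappears and both sides
    -- agree outright; otherwise a commutation relation of lower rank remains.
    rcases Nat.lt_or_ge k i with hk | hk
    · simp only [sigmaPerm_of_lt n s hk, sigmaPerm_of_lt n s (show k < j by omega)]
      rw [hc _ _ (by omega) (by omega)]
    obtain rfl | hk := hk.eq_or_lt
    · simp only [sigmaPerm_self, sigmaPerm_of_lt n s (show i < j by omega),
        sigmaPerm_of_lt n s (show i + 1 < j by omega)]
    obtain rfl | hk := (Nat.succ_le_of_lt hk).eq_or_lt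
    · simp only [Nat.succ_eq_add_one, sigmaPerm_succ, sigmaPerm_of_lt n s (show i < j by omega),
        sigmaPerm_of_lt n s (show i + 1 < j by omega)]
    rcases Nat.lt_or_ge (n + 1) k with hn | hn
    · simp only [sigmaPerm_of_large n s hk hn, sigmaPerm_of_large n s (show j + 1 < k by omega) hn]
    have hgt := fun g => sigmaPerm_of_gt n s hk hn g
    rcases Nat.lt_or_ge k j with hkj | hkj
    -- The remaining indices are `i` and `j - 1`; they still differ by at least two because `i + 1 <
    -- k < j`.
    · simp only [hgt, sigmaPerm_of_lt n s hkj]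
      rw [hc _ _ (by omega) (by omega)]
    obtain rfl | hkj := hkj.eq_or_lt
    · simp only [hgt, sigmaPerm_self, sigmaPerm_of_gt n s (show i + 1 < j + 1 by omega)
        (show j + 1 ≤ n + 1 by omega)]
    obtain rfl | hkj := (Nat.succ_le_of_lt hkj).eq_or_lt
    · simp only [Nat.succ_eq_add_one] at hgt ⊢
      simp only [hgt, sigmaPerm_succ, sigmaPerm_of_gt n s (show i + 1 < j by omega)
        (show j ≤ n + 1 by omega)]
    · simp only [hgt, sigmaPerm_of_gt n s hkj hn]
      rw [hc _ _ hij (by omega)]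
  · rintro ⟨k, g⟩
    simp only [Equiv.Perm.mul_apply]
    -- A strand at `i`, `i + 1` or `i + 2` takes two of the three crossings with it, and the third
    -- becomes `s i` on both sides.
    rcases Nat.lt_or_ge k i with hk | hk
    · simp only [sigmaPerm_of_lt n s hk, sigmaPerm_of_lt n s (show k < i + 1 by omega)]
      have := hb (i - 1) (by omega) g
      rw [show i - 1 + 1 = i by omega] at this
      simp [this]
    obtain rfl | hk := hk.eq_or_lt
    · simp only [sigmaPerm_self, sigmaPerm_of_lt n s (Nat.lt_succ_self i),
        sigmaPerm_of_gt n s (Nat.lt_succ_self (i + 1)) (show i + 1 + 1 ≤ n + 1 by omega)]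
      simp
    obtain rfl | hk := (Nat.succ_le_of_lt hk).eq_or_lt
    · simp only [Nat.succ_eq_add_one, sigmaPerm_succ, sigmaPerm_self,
        sigmaPerm_of_lt n s (Nat.lt_succ_self i),
        sigmaPerm_of_gt n s (Nat.lt_succ_self (i + 1)) (show i + 1 + 1 ≤ n + 1 by omega)]
      simp
    obtain rfl | hk := (Nat.succ_le_of_lt hk).eq_or_lt
    · simp only [Nat.succ_eq_add_one, sigmaPerm_succ,
        sigmaPerm_of_lt n s (Nat.lt_succ_self i),
        sigmaPerm_of_gt n s (Nat.lt_succ_self (i + 1)) (show i + 1 + 1 ≤ n + 1 by omega)]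
      simp
    rcases Nat.lt_or_ge (n + 1) k with hn | hn
    · simp only [sigmaPerm_of_large n s (show i + 1 < k by omega) hn,
        sigmaPerm_of_large n s hk hn]
    · simp only [sigmaPerm_of_gt n s (show i + 1 < k by omega) hn, sigmaPerm_of_gt n s hk hn]
      rw [hb _ (by omega)]

/-- Forgetting strands turns the relations of type `B_{n+1}` into those of type `B_{n+2}`. -/
theorem IsBraidB.sigmaPerm {n : ℕ} {s : ℕ → G} {t : G} (h : IsBraidB n s t) :
    IsBraidB (n + 1) (sigmaPerm n s) (tPerm n t) := by
  have hc : ∀ i, 1 ≤ i → i < n → ∀ g, s i * (t * g) = t * (s i * g) :=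
    fun i hi hin g => by rw [← mul_assoc, h.comm_t i hi hin, mul_assoc]
  refine ⟨h.toIsBraidA.sigmaPerm, fun i hi hin => Equiv.ext ?_, fun _ => Equiv.ext ?_⟩
  · rintro ⟨k, g⟩
    simp only [Equiv.Perm.mul_apply]
    rcases Nat.eq_zero_or_pos k with rfl | hk
    · simp only [tPerm_zero, sigmaPerm_of_lt n s (show 0 < i by omega)]
    rcases Nat.lt_or_ge (n + 1) k with hn | hn
    · simp only [tPerm_of_large n t hn, sigmaPerm_of_large n s (show i + 1 < k by omega) hn]
    have ht := fun g => tPerm_of_pos n t hk hn g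
    rcases Nat.lt_or_ge k i with hki | hki
    · simp only [ht, sigmaPerm_of_lt n s hki]
      rw [hc _ (by omega) (by omega)]
    obtain rfl | hki := hki.eq_or_lt
    · simp only [ht, sigmaPerm_self, tPerm_of_pos n t (Nat.succ_pos i) (show i + 1 ≤ n + 1 by omega)]
    obtain rfl | hki := (Nat.succ_le_of_lt hki).eq_or_lt
    · simp only [Nat.succ_eq_add_one] at ht ⊢
      simp only [ht, sigmaPerm_succ, tPerm_of_pos n t hi (show i ≤ n + 1 by omega)]
    · simp only [ht, sigmaPerm_of_gt n s hki hn]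
      rw [hc _ hi (by omega)]
  · rintro ⟨k, g⟩
    simp only [Equiv.Perm.mul_apply]
    have ht1 := fun g => tPerm_of_pos n t Nat.one_pos (show 1 ≤ n + 1 by omega) g
    have hs0 := fun g => sigmaPerm_self n s 0 g
    have hs1 := fun g => sigmaPerm_succ n s 0 g
    simp only [zero_add] at hs0 hs1
    -- If the strand at `0` or `1` is removed, both sides reduce to a single `t`.
    rcases Nat.eq_zero_or_pos k with rfl | hk
    · simp only [tPerm_zero, ht1, hs0, hs1]
    obtain rfl | hk := (Nat.succ_le_of_lt hk).eq_or_lt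
    · simp only [Nat.succ_eq_add_one, zero_add, tPerm_zero, ht1, hs0, hs1]
    rcases Nat.lt_or_ge (n + 1) k with hn | hn
    · simp only [tPerm_of_large n t hn, sigmaPerm_of_large n s (show 0 + 1 < k by omega) hn]
    · simp only [tPerm_of_pos n t (show 0 < k by omega) hn,
        sigmaPerm_of_gt n s (show 0 + 1 < k by omega) hn]
      have := congrArg (· * g) (h.braid_t (by omega))
      simp only [mul_assoc] at this
      rw [this]

/-- The homomorphism `B(B_{n+1}) → B(B_{n+2})` fixing the names of the generators is injective. -/
theorem BraidB.injective_of_map_generators {n : ℕ} (y : BraidB n →* BraidB (n + 1))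
    (hs : ∀ j, y (sigma j) = sigma j.castSucc) (ht : y t = t) : Function.Injective y := by
  obtain ⟨f, hfs, hft⟩ := (isBraidB_sigma n).sigmaPerm.exists_hom
  -- The image of `y` never moves the strand at `n + 1`; removing it returns `b`, which is thus
  -- recovered from `y b`.
  have key : ∀ b g, f (y b) (n + 1, g) = (n + 1, b * g) := by
    intro b
    induction b using PresentedGroup.induction_on with | _ w
    induction w using FreeGroup.induction_on with
    | C1 => simp
    | of x =>
      intro g
      cases x with
      | sigma i =>
        change f (y (sigma i)) (n + 1, g) = (n + 1, sigma i * g)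
        rw [hs, hfs, Fin.val_castSucc, sigmaPerm_of_gt n _ (by omega) le_rfl, extendOne_val]
      | t =>
        change f (y t) (n + 1, g) = (n + 1, t * g)
        rw [ht, hft, tPerm_of_pos n _ (by omega) le_rfl]
    | inv_of x ih =>
      intro g
      rw [map_inv, map_inv, map_inv, Equiv.Perm.inv_eq_iff_eq, ih, mul_inv_cancel_left]
    | mul u v hu hv =>
      intro g
      rw [map_mul, map_mul, map_mul, Equiv.Perm.mul_apply, hv, hu, mul_assoc]
  intro b c hbc
  have := (key b 1).symm.trans ((congrArg (fun z => f z (n + 1, 1)) hbc).trans (key c 1))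
  simpa using this

end Forget

/-! ### `B(Ã_n)` embeds into `B(B_{n+1})` -/

/-- The rotation `σ_1 ↦ σ_2 ↦ ⋯ ↦ σ_n ↦ a_{n+1} ↦ σ_1` is an automorphism of `B(Ã_n)`. -/
theorem BraidAff.exists_rotation (n : ℕ) : ∃ ρ : MulAut (BraidAff (n + 1)),
    (∀ i < n, ρ (extendOne sigma i) = extendOne sigma (i + 1)) ∧
      ρ (extendOne sigma n) = a ∧ ρ a = extendOne sigma 0 := by
  have h := isBraidAff_sigma (n + 1)
  obtain ⟨f, hfs, hfa⟩ := h.rotate.exists_hom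
  obtain ⟨g, hgs, hga⟩ := h.rotate_symm.exists_hom
  have hfs' : ∀ i < n + 1, f (extendOne sigma i) =
      if i < n then extendOne sigma (i + 1) else a := fun i hi => by
    rw [extendOne_of_lt _ hi, hfs]
  have hgs' : ∀ i < n + 1, g (extendOne sigma i) =
      if i = 0 then a else extendOne sigma (i - 1) := fun i hi => by
    rw [extendOne_of_lt _ hi, hgs]
  have hgf : g.comp f = MonoidHom.id _ := by
    refine BraidAff.hom_ext (fun j => ?_) ?_
    · rw [MonoidHom.comp_apply, hfs, MonoidHom.id_apply]
      split_ifs with hj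
      · rw [hgs' _ (by omega), if_neg (by omega), Nat.add_sub_cancel, extendOne_val]
      · rw [hga, ← extendOne_val sigma j, show (j : ℕ) = n by omega]
    · rw [MonoidHom.comp_apply, hfa, hgs' _ (by omega), if_pos rfl, MonoidHom.id_apply]
  have hfg : f.comp g = MonoidHom.id _ := by
    refine BraidAff.hom_ext (fun j => ?_) ?_
    · rw [MonoidHom.comp_apply, hgs, MonoidHom.id_apply]
      split_ifs with hj
      · rw [hfa, ← extendOne_val sigma j, hj]
      · rw [hfs' _ (by omega), if_pos (by omega), show (j : ℕ) - 1 + 1 = j by omega,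
          extendOne_val]
    · rw [MonoidHom.comp_apply, hga, hfs' _ (by omega), if_neg (by omega), MonoidHom.id_apply]
  refine ⟨f.toMulEquiv g hgf hfg, fun i hi => ?_, ?_, hfa⟩
  · exact (hfs' i (by omega)).trans (if_pos hi)
  · exact (hfs' n (by omega)).trans (if_neg (by omega))

theorem BraidB.a_eq_initProd (n : ℕ) :
    a n = t * initProd (extendOne sigma) (n + 1) * extendOne sigma n *
      (t * initProd (extendOne sigma) (n + 1))⁻¹ := by
  rw [a, phi, prod_ofFn_eq_initProd _ _ fun j => (extendOne_val sigma j).symm,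
    ← extendOne_val sigma (Fin.last n), Fin.val_last]

/-- The homomorphism `i_{n+1}`. -/
theorem BraidAff.exists_hom_braidB (n : ℕ) : ∃ f : BraidAff (n + 1) →* BraidB (n + 1),
    (∀ j, f (sigma j) = BraidB.sigma j) ∧ f a = BraidB.a n := by
  obtain ⟨f, hs, ha⟩ := (isBraidB_sigma (n + 1)).isBraidAff.exists_hom
  exact ⟨f, fun j => by rw [hs, extendOne_val], by rw [ha, BraidB.a_eq_initProd]⟩

/-- The homomorphism `i_{n+1}` is injective: `B(B_{n+2})` maps to the semidirect product of
`B(Ã_{n+1})` and the infinite cyclic group generated by the rotation. -/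
theorem BraidAff.injective_of_map_generators {n : ℕ} (f : BraidAff (n + 1) →* BraidB (n + 1))
    (hs : ∀ j, f (sigma j) = BraidB.sigma j) (ha : f a = BraidB.a n) : Function.Injective f := by
  obtain ⟨ρ, hρs, hρl, hρa⟩ := BraidAff.exists_rotation n
  let inl := SemidirectProduct.inl (φ := zpowersHom (MulAut (BraidAff (n + 1))) ρ)
  let φ := SemidirectProduct.inr (φ := zpowersHom (MulAut (BraidAff (n + 1))) ρ)
    (Multiplicative.ofAdd 1)
  have hconj : ∀ b, φ * inl b = inl (ρ b) * φ := fun b => by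
    have := SemidirectProduct.inl_aut (φ := zpowersHom (MulAut (BraidAff (n + 1))) ρ)
      (Multiplicative.ofAdd 1) b
    rw [zpowersHom_apply, toAdd_ofAdd, zpow_one, map_inv, eq_mul_inv_iff_mul_eq] at this
    exact this.symm
  let s : ℕ → BraidAff (n + 1) ⋊[zpowersHom (MulAut (BraidAff (n + 1))) ρ] Multiplicative ℤ :=
    fun i => inl (extendOne sigma i)
  have hA : IsBraidA (n + 1) s := (isBraidAff_sigma (n + 1)).toIsBraidA.map inl
  let P := initProd s (n + 1)
  -- `φ * P⁻¹` is the image of `t`, forced by sending `t σ_1 ⋯ σ_{n+1}` to the rotation `φ`.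
  have ht : φ * P⁻¹ * initProd s (n + 1) = φ := inv_mul_cancel_right _ _
  -- Both `φ` and `P` conjugate `s k` to `s (k + 1)`, so their quotient centralizes `s (k + 1)`.
  have hcomm : ∀ i, 1 ≤ i → i < n + 1 → s i * (φ * P⁻¹) = φ * P⁻¹ * s i := by
    intro i hi hin
    obtain ⟨k, rfl⟩ : ∃ k, i = k + 1 := ⟨i - 1, by omega⟩
    have h1 : P * s k = s (k + 1) * P := hA.initProd_mul hin le_rfl
    have h2 : φ * s k = s (k + 1) * φ :=
      (hconj _).trans (by rw [hρs k (by omega)])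
    have h3 : P⁻¹ * s (k + 1) = s k * P⁻¹ := by
      rw [inv_mul_eq_iff_eq_mul, ← mul_assoc, h1, mul_inv_cancel_right]
    rw [← mul_assoc, ← h2, mul_assoc, mul_assoc, h3]
  have hB : IsBraidB (n + 1) s (φ * P⁻¹) := by
    refine ⟨hA, hcomm, fun _ => (hA.phi_sq_iff hcomm).1 ?_⟩
    -- Two rotations take the last `σ` to `a` and then to the first `σ`, as `phi_sq_iff` requires.
    rw [ht, mul_assoc, hconj, ← mul_assoc, hconj, hρl, hρa, mul_assoc]
  obtain ⟨g, hgs, hgt⟩ := hB.exists_hom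
  have hgf : g.comp f = inl := by
    refine BraidAff.hom_ext (fun j => ?_) ?_
    · rw [MonoidHom.comp_apply, hs, hgs]
      exact congrArg inl (extendOne_val sigma j)
    · have hgs' : ∀ i < n + 1, g (extendOne BraidB.sigma i) = s i := fun i hi => by
        rw [extendOne_of_lt _ hi, hgs]
      rw [MonoidHom.comp_apply, ha, BraidB.a_eq_initProd]
      simp only [map_mul, map_inv, map_initProd, hgt]
      rw [initProd_congr hgs', hgs' n (by omega), ht, hconj, hρl,
        mul_inv_cancel_right]
  have hinj : Function.Injective (g.comp f) := by
    rw [hgf]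
    exact SemidirectProduct.inl_injective
  exact Function.Injective.of_comp hinj

/-! ### The homomorphisms between consecutive ranks -/

theorem BraidB.exists_hom_succ (n : ℕ) : ∃ y : BraidB n →* BraidB (n + 1),
    (∀ j, y (sigma j) = sigma j.castSucc) ∧ y t = t := by
  have h := isBraidB_sigma (n + 1)
  have h' : IsBraidB n (extendOne (sigma (n := n + 1))) t :=
    ⟨h.toIsBraidA.mono n.le_succ, fun i hi hin => h.comm_t i hi (by omega),
      fun _ => h.braid_t n.succ_pos⟩
  obtain ⟨y, hs, ht⟩ := h'.exists_hom
  exact ⟨y, fun j => by rw [hs, ← extendOne_val sigma j.castSucc, Fin.val_castSucc], ht⟩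

theorem BraidA.exists_hom_succ (n : ℕ) : ∃ x : BraidA n →* BraidA (n + 1),
    ∀ j, x (sigma j) = sigma j.castSucc := by
  obtain ⟨x, hs⟩ := ((isBraidA_sigma (n + 1)).mono n.le_succ).exists_hom
  exact ⟨x, fun j => by rw [hs, ← extendOne_val sigma j.castSucc, Fin.val_castSucc]⟩

theorem BraidA.b_eq_initProd (n : ℕ) :
    b n = (initProd (fun i => extendOne sigma (i + 1)) n)⁻¹ * extendOne sigma 0 *
      initProd (fun i => extendOne (sigma (n := n + 1)) (i + 1)) n := by
  rw [b, prod_ofFn_eq_initProd (fun i : Fin n => sigma i.succ)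
    (fun i => extendOne (sigma (n := n + 1)) (i + 1)) fun j => by
      rw [← extendOne_val sigma j.succ, Fin.val_succ], ← extendOne_val sigma 0, Fin.val_zero]

/-- The homomorphism `β_{n+1}`: the composite of `i_{n+1}` and `B(B_{n+2}) → B(A_{n+1})`,
`t ↦ 1`. -/
theorem BraidAff.exists_hom_braidA (n : ℕ) : ∃ β : BraidAff (n + 1) →* BraidA (n + 1),
    (∀ j, β (sigma j) = BraidA.sigma j) ∧ β a = BraidA.b n := by
  have h := isBraidA_sigma (n + 1)
  have hB : IsBraidB (n + 1) (extendOne (BraidA.sigma (n := n + 1))) 1 :=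
    ⟨h, fun i _ _ => by simp, fun _ => by simp⟩
  obtain ⟨β, hs, ha⟩ := hB.isBraidAff.exists_hom
  refine ⟨β, fun j => by rw [hs, extendOne_val], ?_⟩
  rw [ha, one_mul, BraidA.b_eq_initProd, ← h.initProd_conj (Nat.lt_succ_self n), initProd_succ]
  group

/-- The image of `a_{n+1}` under `B(B_{n+1}) → B(B_{n+2})`. -/
theorem BraidB.map_a {n : ℕ} (y : BraidB (n + 1) →* BraidB (n + 2))
    (hs : ∀ j, y (sigma j) = sigma j.castSucc) (ht : y t = t) :
    y (a n) = sigma (Fin.last (n + 1)) * a (n + 1) * (sigma (Fin.last (n + 1)))⁻¹ := by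
  have h := isBraidB_sigma (n + 2)
  have hs' : ∀ i < n + 1, y (extendOne sigma i) = extendOne sigma i := fun i hi => by
    rw [extendOne_of_lt _ hi, hs, ← extendOne_val sigma (Fin.castSucc _), Fin.val_castSucc]
  rw [a_eq_initProd, a_eq_initProd, ← extendOne_val sigma (Fin.last (n + 1)), Fin.val_last]
  simp only [map_mul, map_inv, map_initProd, ht]
  rw [initProd_congr hs', hs' n (by omega)]
  have hb := h.braid n (by omega)
  have h1 := h.initProd_mul_of_lt (Nat.lt_succ_self n) (by omega)
  have h2 := h.comm_t (n + 1) (by omega) (by omega)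
  simp only [initProd_succ]
  set s := extendOne (sigma (n := n + 2))
  -- `ψ` omits `s n`, so it commutes with `s (n + 1)`; one braid relation between `s n` and `s (n +
  -- 1)` then suffices.
  set ψ := t * initProd s n with hψ
  have h3 : s (n + 1) * ψ = ψ * s (n + 1) := by rw [hψ, ← mul_assoc, h2, mul_assoc, mul_assoc, h1]
  calc t * (initProd s n * s n) * s n * (t * (initProd s n * s n))⁻¹
      = ψ * s n * ψ⁻¹ := by rw [hψ]; group
    _ = ψ * (s n * s (n + 1) * s n) * (s n)⁻¹ * (s (n + 1))⁻¹ * ψ⁻¹ := by group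
    _ = ψ * s (n + 1) * (s n * s (n + 1) * (s n)⁻¹) * (ψ * s (n + 1))⁻¹ := by rw [hb]; group
    _ = s (n + 1) * ψ * (s n * s (n + 1) * (s n)⁻¹) * (s (n + 1) * ψ)⁻¹ := by rw [h3]
    _ = _ := by rw [hψ]; group

/-- The image of `b_{n+1}` under `B(A_{n+1}) → B(A_{n+2})`. -/
theorem BraidA.map_b {n : ℕ} (x : BraidA (n + 1) →* BraidA (n + 2))
    (hs : ∀ j, x (sigma j) = sigma j.castSucc) :
    x (b n) = sigma (Fin.last (n + 1)) * b (n + 1) * (sigma (Fin.last (n + 1)))⁻¹ := by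
  have hs' : ∀ i < n + 1, x (extendOne sigma i) = extendOne sigma i := fun i hi => by
    rw [extendOne_of_lt _ hi, hs, ← extendOne_val sigma (Fin.castSucc _), Fin.val_castSucc]
  rw [b_eq_initProd, b_eq_initProd, ← extendOne_val sigma (Fin.last (n + 1)), Fin.val_last,
    initProd_succ]
  simp only [map_mul, map_inv, map_initProd]
  rw [hs' 0 (by omega), initProd_congr fun i hi => hs' (i + 1) (by omega)]
  -- No braid relation is needed: the longer word is the shorter one conjugated by the last
  -- generator.
  group

/-- A homomorphism from `B(Ã_n)` that agrees on the generators with an injective homomorphism `f`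
lifts along `f`. -/
theorem BraidAff.exists_lift {n : ℕ} {G H : Type*} [Group G] [Group H] (f : G →* H)
    (hf : Function.Injective f) (g : BraidAff n →* H) (s : ℕ → G) (c : G)
    (hs : ∀ j, g (sigma j) = f (s j)) (ha : g a = f c) :
    ∃ F : BraidAff n →* G, (∀ j, F (sigma j) = s j) ∧ F a = c := by
  refine (IsBraidAff.of_map f hf ?_).exists_hom
  rw [← ha]
  exact IsBraidAff.map_hom g hs

/-- Here `n = m + 2` runs over all integers `n ≥ 2`; the maps `F`, `y`, `x` are `F_n`, `y_n`,
`x_n`, the maps `i₁`, `i₂` are `i_{n-1}`, `i_n`, and `β₁`, `β₂` are `β_{n-1}`, `β_n`. Each of them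
is the homomorphism with the prescribed values on the generators (hence unique); that it
exists is part of the claim. -/
theorem mainTheorem8 (m : ℕ) :
    ∃ (F : BraidAff (m + 1) →* BraidAff (m + 2))
      (y : BraidB (m + 1) →* BraidB (m + 2))
      (i₁ : BraidAff (m + 1) →* BraidB (m + 1))
      (i₂ : BraidAff (m + 2) →* BraidB (m + 2))
      (x : BraidA (m + 1) →* BraidA (m + 2))
      (β₁ : BraidAff (m + 1) →* BraidA (m + 1))
      (β₂ : BraidAff (m + 2) →* BraidA (m + 2)),
      ((∀ j, F (BraidAff.sigma j) = BraidAff.sigma j.castSucc) ∧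
        F BraidAff.a =
          BraidAff.sigma (Fin.last (m + 1)) * BraidAff.a *
            (BraidAff.sigma (Fin.last (m + 1)))⁻¹) ∧
      ((∀ j, y (BraidB.sigma j) = BraidB.sigma j.castSucc) ∧ y BraidB.t = BraidB.t) ∧
      ((∀ j, i₁ (BraidAff.sigma j) = BraidB.sigma j) ∧ i₁ BraidAff.a = BraidB.a m) ∧
      ((∀ j, i₂ (BraidAff.sigma j) = BraidB.sigma j) ∧ i₂ BraidAff.a = BraidB.a (m + 1)) ∧
      (∀ j, x (BraidA.sigma j) = BraidA.sigma j.castSucc) ∧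
      ((∀ j, β₁ (BraidAff.sigma j) = BraidA.sigma j) ∧ β₁ BraidAff.a = BraidA.b m) ∧
      ((∀ j, β₂ (BraidAff.sigma j) = BraidA.sigma j) ∧ β₂ BraidAff.a = BraidA.b (m + 1)) ∧
      Function.Injective F ∧
      Function.Injective y ∧
      Function.Injective i₁ ∧
      Function.Injective i₂ ∧
      i₂.comp F = y.comp i₁ ∧
      x.comp β₁ = β₂.comp F := by
  obtain ⟨y, hys, hyt⟩ := BraidB.exists_hom_succ (m + 1)
  obtain ⟨i₁, h₁s, h₁a⟩ := BraidAff.exists_hom_braidB m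
  obtain ⟨i₂, h₂s, h₂a⟩ := BraidAff.exists_hom_braidB (m + 1)
  obtain ⟨x, hx⟩ := BraidA.exists_hom_succ (m + 1)
  obtain ⟨β₁, hβ₁s, hβ₁a⟩ := BraidAff.exists_hom_braidA m
  obtain ⟨β₂, hβ₂s, hβ₂a⟩ := BraidAff.exists_hom_braidA (m + 1)
  have hy := BraidB.injective_of_map_generators y hys hyt
  have h₁ := BraidAff.injective_of_map_generators i₁ h₁s h₁a
  have h₂ := BraidAff.injective_of_map_generators i₂ h₂s h₂a
  obtain ⟨F, hFs, hFa⟩ := BraidAff.exists_lift i₂ h₂ (y.comp i₁)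
    (extendOne BraidAff.sigma) (BraidAff.sigma (Fin.last (m + 1)) * BraidAff.a *
      (BraidAff.sigma (Fin.last (m + 1)))⁻¹)
    (fun j => by
      rw [MonoidHom.comp_apply, h₁s, hys, ← Fin.val_castSucc j, extendOne_val, h₂s])
    (by rw [MonoidHom.comp_apply, h₁a, BraidB.map_a y hys hyt, map_mul, map_mul, map_inv, h₂s,
      h₂a])
  have hFs' : ∀ j, F (BraidAff.sigma j) = BraidAff.sigma j.castSucc := fun j => by
    rw [hFs, ← Fin.val_castSucc j, extendOne_val]
  have hcomp : i₂.comp F = y.comp i₁ := by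
    refine BraidAff.hom_ext (fun j => ?_) ?_
    · simp only [MonoidHom.comp_apply, hFs', h₂s, h₁s, hys]
    · simp only [MonoidHom.comp_apply, hFa, map_mul, map_inv, h₂s, h₂a, h₁a,
        BraidB.map_a y hys hyt]
  have hF : Function.Injective F := by
    have : Function.Injective (i₂.comp F) := by
      rw [hcomp]
      exact hy.comp h₁
    exact Function.Injective.of_comp this
  refine ⟨F, y, i₁, i₂, x, β₁, β₂, ⟨hFs', hFa⟩, ⟨hys, hyt⟩, ⟨h₁s, h₁a⟩, ⟨h₂s, h₂a⟩, hx,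
    ⟨hβ₁s, hβ₁a⟩, ⟨hβ₂s, hβ₂a⟩, hF, hy, h₁, h₂, hcomp, BraidAff.hom_ext (fun j => ?_) ?_⟩
  · simp only [MonoidHom.comp_apply, hβ₁s, hFs', hβ₂s, hx]
  · simp only [MonoidHom.comp_apply, hβ₁a, hFa, map_mul, map_inv, hβ₂s, hβ₂a, BraidA.map_b x hx]
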